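/- For $m\in\mathbb{N}=\{1,2,3,\dots\}$ let $\zeta_m=e^{2\pi i/m}$ and let $\mathbb{Q}(\zeta_m)^+=\mathbb{Q}(\zeta_m)\cap\mathbb{R}$. For $m\ge 4$ let $$D_m=\{(k_1,k_2,k_3,k_4)\in\mathbb{N}^4 : k_3<k_1\le k_2<k_4\le m-1,\ k_1+k_2=k_3+k_4\},$$ $$f_m(k_1,k_2,k_3,k_4)=\frac{(1-\zeta_m^{k_1})(1-\zeta_m^{k_2})}{(1-\zeta_m^{k_3})(1-\zeta_m^{k_4})},\qquad \mathcal{C}_m=f_m(D_m),\qquad \mathcal{C}=\bigcup_{m\ge 4}\mathcal{C}_m,$$ and for $K\subset\mathbb{C}$ put $\mathcal{C}(K)=\mathcal{C}\cap K$, $\mathcal{C}_m(K)=\mathcal{C}_m\cap K$. Let $n\in\mathbb{N}$ and $M=\operatorname{lcm}(2n,12)$. Then $$\mathcal{C}(\mathbb{Q}(\zeta_n)^+)=\mathcal{C}_M(\mathbb{Q}(\zeta_n)^+),$$ and this set is finite. Moreover, there is a finite list $S\subset D_M$, depending only on $n$, such that for all $m\ge 4$ and $d\in D_m$ one has $f_m(d)\in\mathbb{Q}(\zeta_n)^+$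 if and only if at least one of the following holds: (1) $f_m(d)=2$, and for some integers $s\ge 2$ and $k$ with $m=2s$, either $d=(2k,s,k,k+s)$ with $1\le k\le s/2$, or $d=(s,2k,k,k+s)$ with $s/2\le k<s$; (2) there are $d'\in S$ and a rational number $c>0$ with $m=cM$ and $d=c\,d'$ (that is, up to multiplication of $m$ and $d$ by the same factor, $(m,d)$ is $(M,d')$). -/

import Mathlib

open scoped Real

noncomputable section

/-- The primitive `m`-th root of unity `ζ_m = e^{2πi/m}` (for `m ≥ 1`). -/
def zetaRoot (m : ℕ) : ℂ := Complex.exp (2 * π * Complex.I / m)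

/-- The real numbers as a subfield of `ℂ` (over `ℚ`). -/
def realSubfield : IntermediateField ℚ ℂ :=
  (Complex.ofRealAm.restrictScalars ℚ).fieldRange

/-- The maximal real subfield `ℚ(ζ_n)⁺ = ℚ(ζ_n) ∩ ℝ` of the `n`-th cyclotomic field. -/
def realCyclotomic (n : ℕ) : IntermediateField ℚ ℂ :=
  IntermediateField.adjoin ℚ {zetaRoot n} ⊓ realSubfield

/-- The set `D_m` of quadruples `d = (k₁, k₂, k₃, k₄)` of positive integers with
`k₃ < k₁ ≤ k₂ < k₄ ≤ m - 1` and `k₁ + k₂ = k₃ + k₄`; here `kᵢ₊₁ = d i`. -/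
def tupleSet (m : ℕ) : Set (Fin 4 → ℕ) :=
  {d | (∀ i, 0 < d i) ∧ d 2 < d 0 ∧ d 0 ≤ d 1 ∧ d 1 < d 3 ∧ d 3 < m ∧
    d 0 + d 1 = d 2 + d 3}

/-- The function `f_m(k₁, k₂, k₃, k₄) =
(1 - ζ_m^{k₁}) (1 - ζ_m^{k₂}) / ((1 - ζ_m^{k₃}) (1 - ζ_m^{k₄}))`; it is only used on `D_m`,
where the denominator does not vanish. -/
def crossF (m : ℕ) (d : Fin 4 → ℕ) : ℂ :=
  ((1 - zetaRoot m ^ d 0) * (1 - zetaRoot m ^ d 1)) /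
    ((1 - zetaRoot m ^ d 2) * (1 - zetaRoot m ^ d 3))

/-- `𝒞_m = f_m(D_m)`. -/
def crossSet (m : ℕ) : Set ℂ := crossF m '' tupleSet m

/-- `𝒞 = ⋃_{m ≥ 4} 𝒞_m`. -/
def crossSetAll : Set ℂ := {z | ∃ m : ℕ, 4 ≤ m ∧ z ∈ crossSet m}

/-- The first infinite family: `m = 2s` and `d = (2k, s, k, k + s)` with `s ≥ 2` and
`1 ≤ k ≤ s / 2`. -/
def IsFirstFamily (m : ℕ) (d : Fin 4 → ℕ) : Prop :=
  ∃ s k : ℕ, 2 ≤ s ∧ 1 ≤ k ∧ 2 * k ≤ s ∧ m = 2 * s ∧ d = ![2 * k, s, k, k + s]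

/-- The second infinite family: `m = 2s` and `d = (s, 2k, k, k + s)` with `s ≥ 2` and
`s / 2 ≤ k < s`. -/
def IsSecondFamily (m : ℕ) (d : Fin 4 → ℕ) : Prop :=
  ∃ s k : ℕ, 2 ≤ s ∧ s ≤ 2 * k ∧ k < s ∧ m = 2 * s ∧ d = ![s, 2 * k, k, k + s]

/-- `(m, d)` and `(m', d')` agree up to multiplication of both entries by the same (positive
rational) factor. -/
def SameUpToFactor (m : ℕ) (d : Fin 4 → ℕ) (m' : ℕ) (d' : Fin 4 → ℕ) : Prop :=
  ∃ c : ℚ, 0 < c ∧ (m : ℚ) = c * m' ∧ ∀ i, (d i : ℚ) = c * d' i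

end

open Polynomial IntermediateField

/-! Put `x = e^{πi(k₂-k₁)/m}`, `y = e^{πi(k₄-k₃)/m}`, `z = e^{πi(k₁+k₂)/m}`. Then `f = f_m(d)` is a
real number `> 1` and `(x + x⁻¹) - f (y + y⁻¹) + (f - 1)(z + z⁻¹) = 0`
(`exists_three_cosine_relation`).

If `f ∈ ℚ(ζ_n)`, let `T` be the lcm of `n` and the orders of `x, y, z`. When those orders do not all
divide `M`, some prime `p` lets the relation be sorted by exponent modulo `p` (modulo `4` if `p =
2`) over a smaller cyclotomic field containing `f`. Linear independence makes each class sum vanish,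
except possibly when `p = 5` and all classes are occupied, which integrality excludes. A vanishing
class sum has at most one term from each conjugate pair, with coefficients of modulus `1, f, f - 1`;
comparing norms leaves only `f = 2`, `y + y⁻¹ = 0` (`eq_two_of_classSum_eq_zero`).

So either `x, y, z` are `M`-th roots of unity (`pow_lcm_eq_one_or_eq_two`) and `d` rescales to level
`M`, or `d` lies in one of the two families, whose value `2` already occurs at level `M`. -/

/-! ### Degrees of cyclotomic extensions -/

theorem finrank_adjoin_primitiveRoot {a : ℕ} (ha : 0 < a) {θ : ℂ} (hθ : IsPrimitiveRoot θ a) :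
    Module.finrank ℚ ℚ⟮θ⟯ = a.totient := by
  rw [IntermediateField.adjoin.finrank (hθ.isIntegral ha).tower_top,
    ← cyclotomic_eq_minpoly_rat hθ ha, natDegree_cyclotomic]

/-- The tower law; it serves to bound the degree of `ρ` over `ℚ(ω)` from below. -/
theorem totient_le_totient_mul_natDegree_minpoly {a b : ℕ} (ha : 0 < a) (hb : 0 < b)
    {θ ω ρ : ℂ} (hθ : IsPrimitiveRoot θ a) (hω : IsPrimitiveRoot ω b)
    (hρ : IsIntegral ℚ ρ) (h : θ ∈ (ℚ⟮ω⟯)⟮ρ⟯) :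
    a.totient ≤ b.totient * (minpoly ℚ⟮ω⟯ ρ).natDegree := by
  have hρ' : IsIntegral ℚ⟮ω⟯ ρ := hρ.tower_top
  rw [← finrank_adjoin_primitiveRoot ha hθ, ← finrank_adjoin_primitiveRoot hb hω,
    ← IntermediateField.adjoin.finrank hρ', Module.finrank_mul_finrank]
  have : FiniteDimensional ℚ ℚ⟮ω⟯ :=
    IntermediateField.adjoin.finiteDimensional (hω.isIntegral hb).tower_top
  have : FiniteDimensional ℚ⟮ω⟯ (ℚ⟮ω⟯)⟮ρ⟯ := IntermediateField.adjoin.finiteDimensional hρ'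
  have : FiniteDimensional ℚ (ℚ⟮ω⟯)⟮ρ⟯ := FiniteDimensional.trans ℚ ℚ⟮ω⟯ _
  have hle : ℚ⟮θ⟯ ≤ ((ℚ⟮ω⟯)⟮ρ⟯).restrictScalars ℚ := by
    rw [IntermediateField.adjoin_simple_le_iff]; exact h
  exact LinearMap.finrank_le_finrank_of_injective
    (f := (IntermediateField.inclusion hle).toLinearMap)
    (IntermediateField.inclusion hle).injective

/-! ### Linear relations sorted by residue class of the exponents -/

theorem emod_toNat_eq_val {q : ℕ} [NeZero q] (k : ℤ) :
    (k % q).toNat = ((k : ZMod q)).val := by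
  have := ZMod.val_intCast (n := q) k
  omega

theorem zpow_eq_zpow_ediv_mul_pow_val {ρ : ℂ} (hρ : ρ ≠ 0) {q : ℕ} [NeZero q] (k : ℤ) :
    ρ ^ k = (ρ ^ q) ^ (k / q) * ρ ^ ((k : ZMod q)).val := by
  rw [← emod_toNat_eq_val, ← zpow_natCast, ← zpow_natCast, ← zpow_mul, ← zpow_add₀ hρ]
  congr 1
  have h1 := Int.emod_nonneg k (b := (q : ℤ)) (by exact_mod_cast NeZero.ne q)
  rw [Int.toNat_of_nonneg h1, Int.mul_ediv_add_emod]

section ClassSums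

variable {F : IntermediateField ℚ ℂ} {ρ : ℂ} {q : ℕ} [NeZero q] {ι : Type*} [Fintype ι]

theorem coeff_eq_zero_of_lt_natDegree_minpoly (P : F[X]) (hP : aeval ρ P = 0)
    (hdeg : P.natDegree < (minpoly F ρ).natDegree) (r : ℕ) : P.coeff r = 0 := by
  have : P = 0 := by
    by_contra h
    have := natDegree_le_of_dvd (minpoly.dvd F ρ hP) h
    omega
  simp [this]

/-- The polynomial over `F` collecting the terms `c i * ρ ^ k i` by the class of `k i`. -/
theorem exists_classPolynomial (hρ : ρ ≠ 0) (hρq : ρ ^ q ∈ F) (c : ι → ℂ) (hc : ∀ i, c i ∈ F)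
    (k : ι → ℤ) : ∃ P : F[X], P.natDegree ≤ q - 1 ∧ aeval ρ P = ∑ i, c i * ρ ^ k i ∧
      ∀ r : ZMod q, (P.coeff r.val : ℂ) * ρ ^ r.val =
        ∑ i, if (k i : ZMod q) = r then c i * ρ ^ k i else 0 := by
  refine ⟨∑ i, C (⟨c i * (ρ ^ q) ^ (k i / q), F.mul_mem (hc i) (zpow_mem hρq _)⟩ : F) *
    X ^ ((k i : ZMod q)).val, ?_, ?_, ?_⟩
  · refine natDegree_sum_le_of_forall_le _ _ fun i _ => (natDegree_C_mul_X_pow_le _ _).trans ?_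
    have := ZMod.val_lt (k i : ZMod q)
    omega
  · simp only [map_sum, map_mul, map_pow, aeval_X, aeval_C]
    refine Finset.sum_congr rfl fun i _ => ?_
    rw [zpow_eq_zpow_ediv_mul_pow_val hρ (q := q) (k i), ← mul_assoc]
    rfl
  · intro r
    simp only [finsetSum_coeff, coeff_C_mul_X_pow, AddSubmonoidClass.coe_finsetSum,
      Finset.sum_mul]
    refine Finset.sum_congr rfl fun i _ => ?_
    by_cases h : (k i : ZMod q) = r
    · rw [if_pos h, if_pos (by rw [h]), zpow_eq_zpow_ediv_mul_pow_val hρ (q := q) (k i), h,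
        ← mul_assoc]
    · rw [if_neg h, if_neg (fun h' => h (ZMod.val_injective q h'.symm))]
      simp

/-- `1, ρ, …, ρ^(q-1)` are independent over `F`, so the polynomial of classes is zero. -/
theorem classSum_eq_zero (hρ : ρ ≠ 0) (hρq : ρ ^ q ∈ F) (hdeg : q ≤ (minpoly F ρ).natDegree)
    (c : ι → ℂ) (hc : ∀ i, c i ∈ F) (k : ι → ℤ) (h : ∑ i, c i * ρ ^ k i = 0) (r : ZMod q) :
    ∑ i, (if (k i : ZMod q) = r then c i * ρ ^ k i else 0) = 0 := by
  obtain ⟨P, hP, hP0, hPr⟩ := exists_classPolynomial hρ hρq c hc k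
  have hq := NeZero.pos q
  rw [← hPr, coeff_eq_zero_of_lt_natDegree_minpoly P (hP0.trans h) (by omega)]
  simp

/-- When the degree is only `q - 1`, the relations among `1, ρ, …, ρ^(q-1)` are the multiples of the
vanishing geometric sum, so all coefficients agree. -/
theorem normalized_classSum_eq (hρ : IsPrimitiveRoot ρ q) (hq1 : 1 < q)
    (hdeg : q - 1 ≤ (minpoly F ρ).natDegree)
    (c : ι → ℂ) (hc : ∀ i, c i ∈ F) (k : ι → ℤ) (h : ∑ i, c i * ρ ^ k i = 0) (r s : ZMod q) :
    ∑ i, (if (k i : ZMod q) = r then c i else 0) =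
      ∑ i, (if (k i : ZMod q) = s then c i else 0) := by
  have hρ0 : ρ ≠ 0 := hρ.ne_zero (by omega)
  obtain ⟨P, hP, hP0, hPr⟩ := exists_classPolynomial hρ0 (hρ.pow_eq_one ▸ F.one_mem) c hc k
  have key : ∀ r : ZMod q, (P.coeff r.val : ℂ) = ∑ i, (if (k i : ZMod q) = r then c i else 0) := by
    intro r
    refine mul_right_cancel₀ (pow_ne_zero r.val hρ0) ((hPr r).trans ?_)
    rw [Finset.sum_mul]
    refine Finset.sum_congr rfl fun i _ => ?_
    split_ifs with hi
    · rw [zpow_eq_zpow_ediv_mul_pow_val hρ0 (q := q) (k i), hi, hρ.pow_eq_one, one_zpow, one_mul]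
    · simp
  -- Removing the multiple of the geometric sum that kills the top coefficient brings the degree
  -- below `q - 1`.
  set Q : F[X] := P - C (P.coeff (q - 1)) * ∑ i ∈ Finset.range q, X ^ i with hQ
  have hQc : ∀ r < q, Q.coeff r = P.coeff r - P.coeff (q - 1) := by
    intro r hr
    simp [hQ, coeff_X_pow, hr]
  have hQd : Q.natDegree < q - 1 := by
    have h1 : Q.natDegree ≤ q - 1 := by
      refine (natDegree_sub_le _ _).trans (max_le hP ((natDegree_C_mul_le _ _).trans ?_))
      refine natDegree_sum_le_of_forall_le _ _ fun i hi => ?_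
      rw [natDegree_X_pow]
      have := Finset.mem_range.1 hi
      omega
    refine lt_of_le_of_ne h1 fun h2 => ?_
    have h3 : Q.coeff (q - 1) = 0 := by rw [hQc _ (by omega), sub_self]
    rw [← h2, ← leadingCoeff, leadingCoeff_eq_zero] at h3
    rw [h3, natDegree_zero] at h2
    omega
  have hQ0 : aeval ρ Q = 0 := by
    simp [hQ, hP0, h, hρ.geom_sum_eq_zero hq1]
  have hc' : ∀ r < q, P.coeff r = P.coeff (q - 1) := fun r hr => by
    rw [← sub_eq_zero, ← hQc r hr]
    exact coeff_eq_zero_of_lt_natDegree_minpoly Q hQ0 (by omega) r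
  rw [← key, ← key, hc' _ (ZMod.val_lt r), hc' _ (ZMod.val_lt s)]

theorem classSum_eq_zero_of_empty_class (hρ : IsPrimitiveRoot ρ q) (hq1 : 1 < q)
    (hdeg : q - 1 ≤ (minpoly F ρ).natDegree)
    (c : ι → ℂ) (hc : ∀ i, c i ∈ F) (k : ι → ℤ) (h : ∑ i, c i * ρ ^ k i = 0)
    (s : ZMod q) (hs : ∀ i, (k i : ZMod q) ≠ s) (r : ZMod q) :
    ∑ i, (if (k i : ZMod q) = r then c i * ρ ^ k i else 0) = 0 := by
  have h0 := normalized_classSum_eq hρ hq1 hdeg c hc k h r s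
  simp only [hs, if_false, Finset.sum_const_zero] at h0
  have hρ0 : ρ ≠ 0 := hρ.ne_zero (by omega)
  refine Eq.trans ?_ ((congrArg (· * ρ ^ r.val) h0).trans (zero_mul _))
  rw [Finset.sum_mul]
  refine Finset.sum_congr rfl fun i _ => ?_
  split_ifs with hi
  · rw [zpow_eq_zpow_ediv_mul_pow_val hρ0 (q := q) (k i), hi, hρ.pow_eq_one, one_zpow, one_mul]
  · simp

end ClassSums

/-! ### Norm comparison in a vanishing class sum -/

/-- Equality in the triangle inequality: `x + (f - 1) z` has norm `f = 1 + (f - 1)`. -/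
theorem eq_of_convex_combination_norm_one {x y z : ℂ} (hx : ‖x‖ = 1) (hy : ‖y‖ = 1)
    (hz : ‖z‖ = 1) {f : ℝ} (hf : 1 < f) (h : x - f * y + (f - 1) * z = 0) : x = z := by
  have sq : ∀ t : ℂ, ‖t‖ = 1 → t.re ^ 2 + t.im ^ 2 = 1 := fun t ht => by
    have := Complex.sq_norm t
    rw [ht, Complex.normSq_apply] at this
    linarith
  have hx2 := sq x hx
  have hy2 := sq y hy
  have hz2 := sq z hz
  have hre := congrArg Complex.re h
  have him := congrArg Complex.im h
  simp at hre him
  have e1 : f * y.re = x.re + (f - 1) * z.re := by linarith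
  have e2 : f * y.im = x.im + (f - 1) * z.im := by linarith
  have e3 : f ^ 2 = 1 + (f - 1) ^ 2 + 2 * (f - 1) * (x.re * z.re + x.im * z.im) := by
    have : (f * y.re) ^ 2 + (f * y.im) ^ 2 = f ^ 2 := by linear_combination f ^ 2 * hy2
    rw [e1, e2] at this
    linear_combination -this + hx2 + (f - 1) ^ 2 * hz2
  have e4 : x.re * z.re + x.im * z.im = 1 := by
    have : (f - 1) * (x.re * z.re + x.im * z.im - 1) = 0 := by linear_combination -e3 / 2
    rcases mul_eq_zero.1 this with h | h <;> linarith
  have e5 : (x.re - z.re) ^ 2 + (x.im - z.im) ^ 2 = 0 := by linear_combination hx2 + hz2 - 2 * e4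
  apply Complex.ext <;> nlinarith [sq_nonneg (x.re - z.re), sq_nonneg (x.im - z.im)]

section Core

variable {A : Type*} [AddCommGroup A] [DecidableEq A]

theorem pairSum_cases {t : A} (ht : t ≠ -t) (v : A) (c y : ℂ) :
    (if v = t then c * y else 0) + (if -v = t then c * y⁻¹ else 0) = 0 ∨
    ∃ Y, (Y = y ∨ Y = y⁻¹) ∧
      (if v = t then c * y else 0) + (if -v = t then c * y⁻¹ else 0) = c * Y := by
  by_cases h1 : v = t
  · have h2 : -v ≠ t := fun h => ht (by rw [← h, neg_neg, h, h1])
    exact Or.inr ⟨y, Or.inl rfl, by simp [h1, h1 ▸ h2]⟩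
  · by_cases h2 : -v = t
    · exact Or.inr ⟨y⁻¹, Or.inr rfl, by simp [h1, h2]⟩
    · exact Or.inl (by simp [h1, h2])

theorem pairSum_self {t : A} (ht : t ≠ -t) (c y : ℂ) :
    (if t = t then c * y else 0) + (if -t = t then c * y⁻¹ else 0) = c * y := by
  simp [ht.symm]

theorem pairSum_of_neg_eq {t v : A} (ht : t ≠ -t) (hv : v = -v) (c y : ℂ) :
    (if v = t then c * y else 0) + (if -v = t then c * y⁻¹ else 0) = 0 := by
  have h1 : v ≠ t := fun h => ht (by rw [← h]; exact hv)
  simp [h1, ← hv]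

/-- Look at a class `t ≠ -t`, which meets each pair at most once. A single term cannot vanish; two
terms need equal moduli among `1, f, f - 1`, so only `f - 1 = 1` survives; three terms force `x = z`
or `x = z⁻¹` by convexity. -/
theorem eq_two_of_classSum_eq_zero {u v w : A} {x y z : ℂ} (hx : ‖x‖ = 1) (hy : ‖y‖ = 1)
    (hz : ‖z‖ = 1) {f : ℝ} (hf : 1 < f) (hxz : x ≠ z) (hxz' : x ≠ z⁻¹)
    (h : ∀ r : A, ((if u = r then 1 * x else 0) + (if -u = r then 1 * x⁻¹ else 0)) +
      ((if v = r then -f * y else 0) + (if -v = r then -f * y⁻¹ else 0)) +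
      ((if w = r then (f - 1) * z else 0) + (if -w = r then (f - 1) * z⁻¹ else 0)) = 0)
    (hne : u ≠ -u ∨ v ≠ -v ∨ w ≠ -w)
    (htot : x + x⁻¹ - f * (y + y⁻¹) + (f - 1) * (z + z⁻¹) = 0) :
    f = 2 ∧ y + y⁻¹ = 0 ∧ x + x⁻¹ + (z + z⁻¹) = 0 := by
  have nrm : ∀ {t T : ℂ}, ‖t‖ = 1 → (T = t ∨ T = t⁻¹) → ‖T‖ = 1 := by
    rintro t T ht (rfl | rfl) <;> simp [ht]
  have hfn : ‖(f : ℂ)‖ = f := by rw [Complex.norm_real, Real.norm_of_nonneg (by linarith)]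
  have hfn1 : ‖(f : ℂ) - 1‖ = f - 1 := by
    rw [← Complex.ofReal_one, ← Complex.ofReal_sub, Complex.norm_real,
      Real.norm_of_nonneg (by linarith)]
  by_cases hu : u = -u
  · exfalso
    by_cases hv : v = -v
    · have hw : w ≠ -w := by tauto
      have := h w
      rw [pairSum_self hw, pairSum_of_neg_eq hw hu, pairSum_of_neg_eq hw hv, zero_add, zero_add]
        at this
      have := congrArg norm this
      rw [norm_mul, hz, hfn1, norm_zero] at this
      linarith
    · have := h v
      rw [pairSum_self hv, pairSum_of_neg_eq hv hu, zero_add] at this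
      rcases pairSum_cases hv w (f - 1) z with h0 | ⟨Z, hZ, h0⟩
      · rw [h0] at this
        have := congrArg norm this
        rw [add_zero, norm_mul, norm_neg, hy, hfn, norm_zero] at this
        linarith
      · rw [h0] at this
        have : (f : ℂ) * y = (f - 1) * Z := by linear_combination -this
        have := congrArg norm this
        rw [norm_mul, norm_mul, hy, nrm hz hZ, hfn, hfn1] at this
        linarith
  · have := h u
    rw [pairSum_self hu] at this
    rcases pairSum_cases hu v (-f) y with h0 | ⟨Y, hY, h0⟩
    · rcases pairSum_cases hu w (f - 1) z with h1 | ⟨Z, hZ, h1⟩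
      · rw [h0, h1] at this
        have := congrArg norm this
        simp [hx] at this
      · rw [h0, h1] at this
        have h2 : -x = (f - 1) * Z := by linear_combination -this
        have h3 := congrArg norm h2
        rw [norm_neg, norm_mul, hx, nrm hz hZ, hfn1] at h3
        have hf2 : f = 2 := by linarith
        subst hf2
        have hxZ : x = -Z := by push_cast at h2; linear_combination -h2
        have hs : x + x⁻¹ + (z + z⁻¹) = 0 := by
          rcases hZ with rfl | rfl
          · rw [hxZ, inv_neg]; ring
          · rw [hxZ, inv_neg, inv_inv]; ring
        refine ⟨rfl, ?_, hs⟩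
        push_cast at htot
        linear_combination -htot / 2 + hs / 2
    · exfalso
      rcases pairSum_cases hu w (f - 1) z with h1 | ⟨Z, hZ, h1⟩
      · rw [h0, h1] at this
        have h2 : x = f * Y := by linear_combination this
        have h3 := congrArg norm h2
        rw [norm_mul, hx, nrm hy hY, hfn] at h3
        linarith
      · rw [h0, h1] at this
        have := eq_of_convex_combination_norm_one hx (nrm hy hY) (nrm hz hZ) hf
          (by linear_combination this)
        rcases hZ with rfl | rfl <;> contradiction

end Core

/-! ### The exceptional prime 5 -/

theorem zmod_five_cover : ∀ u v w : ZMod 5,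
    (∀ r, u = r ∨ -u = r ∨ v = r ∨ -v = r ∨ w = r ∨ -w = r) →
    (u = 0 ∧ v ≠ 0 ∧ w ≠ 0 ∧ v ≠ w ∧ v ≠ -w) ∨ (v = 0 ∧ w ≠ 0 ∧ u ≠ 0 ∧ w ≠ u ∧ w ≠ -u) ∨
    (w = 0 ∧ u ≠ 0 ∧ v ≠ 0 ∧ u ≠ v ∧ u ≠ -v) := by decide

theorem zmod_five_ne_neg : ∀ t : ZMod 5, t ≠ 0 → t ≠ -t := by decide

/-- The classes `±v`, `±w` hold one term each, so equality of their sums gives `y = y⁻¹` and `z =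
z⁻¹`; class `0` holds the whole remaining pair. -/
theorem sq_eq_sq_of_zmod_five_classSum_eq {u v w : ZMod 5} {x y z a b c : ℂ}
    (hy : y ≠ 0) (hz : z ≠ 0) (hb : b ≠ 0) (hc : c ≠ 0)
    (h : ∀ r s : ZMod 5, ((if u = r then a * x else 0) + (if -u = r then a * x⁻¹ else 0)) +
      ((if v = r then b * y else 0) + (if -v = r then b * y⁻¹ else 0)) +
      ((if w = r then c * z else 0) + (if -w = r then c * z⁻¹ else 0)) =
      ((if u = s then a * x else 0) + (if -u = s then a * x⁻¹ else 0)) +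
      ((if v = s then b * y else 0) + (if -v = s then b * y⁻¹ else 0)) +
      ((if w = s then c * z else 0) + (if -w = s then c * z⁻¹ else 0)))
    (hu : u = 0) (hv : v ≠ 0) (hw : w ≠ 0) (hvw : v ≠ w) (hvw' : v ≠ -w) :
    b ^ 2 = c ^ 2 ∧ (a * (x + x⁻¹)) ^ 2 = b ^ 2 := by
  subst hu
  have hvv := zmod_five_ne_neg v hv
  have hww := zmod_five_ne_neg w hw
  have hvw2 : -v ≠ w := fun h => hvw' (by rw [← h, neg_neg])
  have h1 := h v (-v)
  have h2 := h w (-w)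
  have h3 := h v w
  have h4 := h v 0
  simp [hv, hw, hvw, hvw', hvv, hww, hvv.symm, hww.symm, hvw.symm, hvw'.symm, hvw2, hvw2.symm,
    hv.symm, hw.symm, hb, hc] at h1 h2 h3 h4
  have hy2 : y ^ 2 = 1 := by rw [sq]; nth_rw 1 [h1]; exact inv_mul_cancel₀ hy
  have hz2 : z ^ 2 = 1 := by rw [sq]; nth_rw 1 [h2]; exact inv_mul_cancel₀ hz
  constructor
  · linear_combination -b ^ 2 * hy2 + c ^ 2 * hz2 + (b * y + c * z) * h3
  · rw [mul_add, ← h4, mul_pow, hy2, mul_one]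

/-- Otherwise `t ^ 2 = 1 / 4` would be an algebraic integer. -/
theorem two_mul_ne_of_isIntegral {t : ℂ} (ht : IsIntegral ℤ t) : (2 * t) ^ 2 ≠ 1 := by
  intro h
  have h1 : IsIntegral ℤ (algebraMap ℚ ℂ (1 / 4)) := by
    have : algebraMap ℚ ℂ (1 / 4) = t ^ 2 := by
      simp only [eq_ratCast]; push_cast; linear_combination -h / 4
    rw [this]; exact ht.pow 2
  rw [isIntegral_algebraMap_iff (algebraMap ℚ ℂ).injective] at h1
  obtain ⟨k, hk⟩ := IsIntegrallyClosed.isIntegral_iff.1 h1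
  simp only [eq_intCast] at hk
  have : ((4 * k : ℤ) : ℚ) = (1 : ℤ) := by push_cast; rw [hk]; norm_num
  have := Int.cast_injective this
  omega

/-- The coefficients of the two nonzero pairs have equal squares. As `f > 1`, this is possible only
for `1` and `f - 1`, so `f = 2`, and then `(2 (y + y⁻¹)) ^ 2 = 1` contradicts integrality. -/
theorem false_of_zmod_five_classSum_eq {u v w : ZMod 5} {x y z : ℂ}
    (hx : x ≠ 0) (hy : y ≠ 0) (hz : z ≠ 0) (hyi : IsIntegral ℤ (y + y⁻¹)) {f : ℝ} (hf : 1 < f)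
    (hcov : ∀ r, u = r ∨ -u = r ∨ v = r ∨ -v = r ∨ w = r ∨ -w = r)
    (h : ∀ r s : ZMod 5, ((if u = r then 1 * x else 0) + (if -u = r then 1 * x⁻¹ else 0)) +
      ((if v = r then -f * y else 0) + (if -v = r then -f * y⁻¹ else 0)) +
      ((if w = r then (f - 1) * z else 0) + (if -w = r then (f - 1) * z⁻¹ else 0)) =
      ((if u = s then 1 * x else 0) + (if -u = s then 1 * x⁻¹ else 0)) +
      ((if v = s then -f * y else 0) + (if -v = s then -f * y⁻¹ else 0)) +
      ((if w = s then (f - 1) * z else 0) + (if -w = s then (f - 1) * z⁻¹ else 0))) : False := by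
  have hf0 : (-f : ℂ) ≠ 0 := by
    rw [neg_ne_zero, Complex.ofReal_ne_zero]; linarith
  have hf1 : (f - 1 : ℂ) ≠ 0 := by
    rw [sub_ne_zero, Ne, Complex.ofReal_eq_one]; linarith
  rcases zmod_five_cover u v w hcov with ⟨h0, h1, h2, h3, h4⟩ | ⟨h0, h1, h2, h3, h4⟩ |
    ⟨h0, h1, h2, h3, h4⟩
  · obtain ⟨e, -⟩ := sq_eq_sq_of_zmod_five_classSum_eq hy hz hf0 hf1 h h0 h1 h2 h3 h4
    have e' : f ^ 2 = (f - 1) ^ 2 := by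
      have : ((f ^ 2 : ℝ) : ℂ) = ((f - 1) ^ 2 : ℝ) := by push_cast; linear_combination e
      exact_mod_cast this
    nlinarith
  · obtain ⟨e, e2⟩ := sq_eq_sq_of_zmod_five_classSum_eq hz hx hf1 one_ne_zero
      (fun r s => by linear_combination h r s) h0 h1 h2 h3 h4
    have e' : (f - 1) ^ 2 = 1 := by
      have : (((f - 1) ^ 2 : ℝ) : ℂ) = (1 : ℝ) := by push_cast; linear_combination e
      exact_mod_cast this
    have e3 : f = 2 := by nlinarith
    subst e3
    refine two_mul_ne_of_isIntegral hyi ?_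
    push_cast at e2
    linear_combination e2
  · obtain ⟨e, -⟩ := sq_eq_sq_of_zmod_five_classSum_eq hx hy one_ne_zero hf0
      (fun r s => by linear_combination h r s) h0 h1 h2 h3 h4
    have e' : f ^ 2 = 1 := by
      have : ((f ^ 2 : ℝ) : ℂ) = (1 : ℝ) := by push_cast; linear_combination -e
      exact_mod_cast this
    nlinarith

/-! ### Three-cosine relations over a cyclotomic field -/

theorem isPrimitiveRoot_zetaRoot {n : ℕ} (hn : 0 < n) : IsPrimitiveRoot (zetaRoot n) n :=
  Complex.isPrimitiveRoot_exp n hn.ne'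

theorem mem_adjoin_of_pow_eq_one {b : ℕ} (hb : 0 < b) {ω x : ℂ} (hω : IsPrimitiveRoot ω b)
    (hx : x ^ b = 1) : x ∈ ℚ⟮ω⟯ := by
  have : NeZero b := ⟨hb.ne'⟩
  obtain ⟨i, -, rfl⟩ := hω.eq_pow_of_pow_eq_one hx
  exact pow_mem (mem_adjoin_simple_self ℚ ω) i

theorem adjoin_zetaRoot_le {n b : ℕ} (hn : 0 < n) (hb : 0 < b) (hnb : n ∣ b) {ω : ℂ}
    (hω : IsPrimitiveRoot ω b) : ℚ⟮zetaRoot n⟯ ≤ ℚ⟮ω⟯ := by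
  rw [adjoin_simple_le_iff]
  exact mem_adjoin_of_pow_eq_one hb hω
    (((isPrimitiveRoot_zetaRoot hn).pow_eq_one_iff_dvd b).2 hnb)

theorem norm_eq_one_of_zpow {ω : ℂ} {b : ℕ} (hb : b ≠ 0) (hω : ω ^ b = 1) (u : ℤ) :
    ‖ω ^ u‖ = 1 := by
  rw [norm_zpow, Complex.norm_eq_one_of_pow_eq_one hω hb, one_zpow]

theorem zpow_pow_eq_one_of_dvd {ζ : ℂ} {T p : ℕ} (hζ : ζ ^ T = 1) (hp : p ∣ T)
    {u : ℤ} (hu : (p : ℤ) ∣ u) : (ζ ^ u) ^ (T / p) = 1 := by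
  obtain ⟨k, rfl⟩ := hu
  rw [← zpow_natCast, ← zpow_mul, mul_right_comm, ← Nat.cast_mul, Nat.mul_div_cancel' hp, zpow_mul,
    zpow_natCast, hζ, one_zpow]

theorem sum_ite_class_six {q : ℕ} (u v w : ℤ) (g : Fin 6 → ℂ) (r : ZMod q) :
    ∑ i, (if (((![u, -u, v, -v, w, -w] : Fin 6 → ℤ) i : ℤ) : ZMod q) = r then g i else 0) =
      (if (u : ZMod q) = r then g 0 else 0) + (if -(u : ZMod q) = r then g 1 else 0) +
      (if (v : ZMod q) = r then g 2 else 0) + (if -(v : ZMod q) = r then g 3 else 0) +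
      (if (w : ZMod q) = r then g 4 else 0) + (if -(w : ZMod q) = r then g 5 else 0) := by
  rw [Fin.sum_univ_six, ← Int.cast_neg, ← Int.cast_neg, ← Int.cast_neg]
  rfl

/-- If `ℚ(ζ_{qb})` has degree `q` over `ℚ(ζ_b)`, a three-cosine relation over `ℚ(ζ_b)` among
`qb`-th roots of unity, not all of order dividing `qb / p`, is degenerate. -/
theorem eq_two_of_totient_mul_eq {n b q p : ℕ} [NeZero q] (hn : 0 < n) (hb : 0 < b) (hnb : n ∣ b)
    (hφ : (q * b).totient = q * b.totient) (hp : p ∣ q * b)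
    (hpq : ∀ j : ℤ, (j : ZMod q) = -(j : ZMod q) → (p : ℤ) ∣ j)
    {x y z : ℂ} {f : ℝ} (hf : 1 < f) (hfn : (f : ℂ) ∈ ℚ⟮zetaRoot n⟯)
    (hxz : x ≠ z) (hxz' : x ≠ z⁻¹)
    (htot : x + x⁻¹ - f * (y + y⁻¹) + (f - 1) * (z + z⁻¹) = 0)
    (hx : x ^ (q * b) = 1) (hy : y ^ (q * b) = 1) (hz : z ^ (q * b) = 1)
    (hne : ¬(x ^ (q * b / p) = 1 ∧ y ^ (q * b / p) = 1 ∧ z ^ (q * b / p) = 1)) :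
    f = 2 ∧ y + y⁻¹ = 0 ∧ x + x⁻¹ + (z + z⁻¹) = 0 := by
  have hq : 0 < q := NeZero.pos q
  have hT : 0 < q * b := Nat.mul_pos hq hb
  have : NeZero (q * b) := ⟨hT.ne'⟩
  set ζ := zetaRoot (q * b)
  have hζ : IsPrimitiveRoot ζ (q * b) := isPrimitiveRoot_zetaRoot hT
  have hζ1 := hζ.pow_eq_one
  have hω : IsPrimitiveRoot (ζ ^ q) b := hζ.pow hT rfl
  have hdeg : q ≤ (minpoly ℚ⟮ζ ^ q⟯ ζ).natDegree := by
    have := totient_le_totient_mul_natDegree_minpoly hT hb hζ hω (hζ.isIntegral hT).tower_top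
      (mem_adjoin_simple_self _ ζ)
    rw [hφ, mul_comm q] at this
    exact Nat.le_of_mul_le_mul_left this (Nat.totient_pos.2 hb)
  have hfF : (f : ℂ) ∈ ℚ⟮ζ ^ q⟯ := adjoin_zetaRoot_le hn hb hnb hω hfn
  obtain ⟨u, -, hu⟩ := hζ.eq_pow_of_pow_eq_one hx
  obtain ⟨v, -, hv⟩ := hζ.eq_pow_of_pow_eq_one hy
  obtain ⟨w, -, hw⟩ := hζ.eq_pow_of_pow_eq_one hz
  rw [← zpow_natCast] at hu hv hw
  generalize (u : ℤ) = u at hu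
  generalize (v : ℤ) = v at hv
  generalize (w : ℤ) = w at hw
  have hsum := classSum_eq_zero (F := ℚ⟮ζ ^ q⟯) (ρ := ζ) (q := q) (hζ.ne_zero hT.ne')
    (mem_adjoin_simple_self ℚ _) hdeg (![1, 1, -f, -f, f - 1, f - 1] : Fin 6 → ℂ)
    (by
      intro i
      fin_cases i
      exacts [one_mem _, one_mem _, neg_mem hfF, neg_mem hfF, sub_mem hfF (one_mem _),
        sub_mem hfF (one_mem _)])
    ![u, -u, v, -v, w, -w]
    (by simp [Fin.sum_univ_six, hu, hv, hw]; linear_combination htot)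
  subst hu hv hw
  refine eq_two_of_classSum_eq_zero (u := (u : ZMod q)) (v := (v : ZMod q)) (w := (w : ZMod q))
    (norm_eq_one_of_zpow hT.ne' hζ1 u) (norm_eq_one_of_zpow hT.ne' hζ1 v)
    (norm_eq_one_of_zpow hT.ne' hζ1 w) hf hxz hxz' (fun r => ?_) ?_ htot
  · have := hsum r
    rw [sum_ite_class_six] at this
    simpa [add_assoc] using this
  · by_contra! h
    exact hne ⟨zpow_pow_eq_one_of_dvd hζ1 hp (hpq _ h.1),
      zpow_pow_eq_one_of_dvd hζ1 hp (hpq _ h.2.1), zpow_pow_eq_one_of_dvd hζ1 hp (hpq _ h.2.2)⟩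

theorem not_cover_of_six_lt {p : ℕ} [NeZero p] (hp : 6 < p) (u v w : ZMod p) :
    ¬ ∀ r, u = r ∨ -u = r ∨ v = r ∨ -v = r ∨ w = r ∨ -w = r := by
  intro h
  have h1 : (Finset.univ : Finset (ZMod p)) ⊆ {u, -u, v, -v, w, -w} := by
    intro r _
    simp only [Finset.mem_insert, Finset.mem_singleton]
    have := h r
    tauto
  have h2 := (Finset.card_le_card h1).trans Finset.card_le_six
  rw [Finset.card_univ, ZMod.card] at h2
  omega

/-- A three-cosine relation over `ℚ(ζ_b)` among `pb`-th roots of unity, not all of them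
`b`-th roots of unity, is degenerate if `p ≥ 5` is a prime not dividing `b`. -/
theorem eq_two_of_prime_not_dvd {n b p : ℕ} (hp : p.Prime) (hp5 : 5 ≤ p) (hpb : ¬ p ∣ b)
    (hn : 0 < n) (hb : 0 < b) (hnb : n ∣ b)
    {x y z : ℂ} {f : ℝ} (hf : 1 < f) (hfn : (f : ℂ) ∈ ℚ⟮zetaRoot n⟯)
    (hxz : x ≠ z) (hxz' : x ≠ z⁻¹)
    (htot : x + x⁻¹ - f * (y + y⁻¹) + (f - 1) * (z + z⁻¹) = 0)
    (hx : x ^ (p * b) = 1) (hy : y ^ (p * b) = 1) (hz : z ^ (p * b) = 1)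
    (hne : ¬(x ^ b = 1 ∧ y ^ b = 1 ∧ z ^ b = 1)) :
    f = 2 ∧ y + y⁻¹ = 0 ∧ x + x⁻¹ + (z + z⁻¹) = 0 := by
  have : NeZero p := ⟨hp.ne_zero⟩
  have : Fact p.Prime := ⟨hp⟩
  have hT : 0 < p * b := Nat.mul_pos hp.pos hb
  have hTz : NeZero (p * b) := ⟨hT.ne'⟩
  obtain ⟨ζ, hζ⟩ : ∃ ζ : ℂ, IsPrimitiveRoot ζ (p * b) := ⟨_, isPrimitiveRoot_zetaRoot hT⟩
  have hζ0 : ζ ≠ 0 := hζ.ne_zero hT.ne'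
  obtain ⟨ω, hω'⟩ : ∃ ω, ω = ζ ^ p := ⟨_, rfl⟩
  obtain ⟨ξ, hξ'⟩ : ∃ ξ, ξ = ζ ^ b := ⟨_, rfl⟩
  have hω : IsPrimitiveRoot ω b := hω' ▸ hζ.pow hT rfl
  have hξ : IsPrimitiveRoot ξ p := hξ' ▸ hζ.pow hT (mul_comm p b)
  have hω0 : ω ≠ 0 := hω.ne_zero hb.ne'
  have hξ0 : ξ ≠ 0 := hξ.ne_zero hp.ne_zero
  have hcop : Nat.Coprime p b := (Nat.Prime.coprime_iff_not_dvd hp).2 hpb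
  -- Bézout splits each `pb`-th root of unity into a `b`-th root, absorbed in the coefficients, and
  -- a power of `ξ`.
  obtain ⟨s, t, hst⟩ : ∃ s t : ℤ, (p : ℤ) * s + b * t = 1 := by
    obtain ⟨s, t, h⟩ := (Nat.isCoprime_iff_coprime.2 hcop)
    exact ⟨s, t, by linarith⟩
  have hdec : ∀ u : ℤ, ζ ^ u = ω ^ (s * u) * ξ ^ (t * u) := by
    intro u
    rw [hω', hξ', ← zpow_natCast, ← zpow_natCast, ← zpow_mul, ← zpow_mul, ← zpow_add₀ hζ0]
    congr 1
    linear_combination -u * hst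
  have hωF : ω ∈ ℚ⟮ω⟯ := mem_adjoin_simple_self ℚ ω
  have hdeg : p - 1 ≤ (minpoly ℚ⟮ω⟯ ξ).natDegree := by
    have := totient_le_totient_mul_natDegree_minpoly hT hb hζ hω (hξ.isIntegral hp.pos).tower_top
      (ρ := ξ) (by
        have h1 := hdec 1
        rw [zpow_one] at h1
        rw [h1]
        refine mul_mem (zpow_mem ?_ _) (zpow_mem (mem_adjoin_simple_self _ ξ) _)
        exact IntermediateField.algebraMap_mem (ℚ⟮ω⟯)⟮ξ⟯ (⟨ω, hωF⟩ : ℚ⟮ω⟯))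
    rw [Nat.totient_mul hcop, Nat.totient_prime hp, mul_comm (p - 1)] at this
    exact Nat.le_of_mul_le_mul_left this (Nat.totient_pos.2 hb)
  have hfF : (f : ℂ) ∈ ℚ⟮ω⟯ := adjoin_zetaRoot_le hn hb hnb hω hfn
  have split : ∀ x : ℂ, x ^ (p * b) = 1 → ∃ (x' : ℂ) (k : ℤ), x = x' * ξ ^ k ∧ x' ∈ ℚ⟮ω⟯ ∧
      x' ^ b = 1 := by
    intro x hx
    obtain ⟨u, -, rfl⟩ := hζ.eq_pow_of_pow_eq_one hx
    refine ⟨ω ^ (s * u), t * u, by rw [← zpow_natCast, hdec], zpow_mem hωF _, ?_⟩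
    rw [← zpow_natCast, ← zpow_mul, mul_comm, zpow_mul, zpow_natCast, hω.pow_eq_one, one_zpow]
  have hξk : ∀ k : ℤ, (k : ZMod p) = -(k : ZMod p) → ξ ^ k = 1 := by
    intro k hk
    rw [hξ.zpow_eq_one_iff_dvd, ← ZMod.intCast_zmod_eq_zero_iff_dvd]
    have h2 : (2 : ZMod p) ≠ 0 := by
      intro h
      have : ((2 : ℕ) : ZMod p) = 0 := by exact_mod_cast h
      rw [ZMod.natCast_eq_zero_iff] at this
      have := Nat.le_of_dvd (by norm_num) this
      omega
    have : (2 : ZMod p) * k = 0 := by linear_combination hk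
    exact (mul_eq_zero.1 this).resolve_left h2
  obtain ⟨x', u, hxu, hxF, hxb⟩ := split x hx
  obtain ⟨y', v, hyv, hyF, hyb⟩ := split y hy
  obtain ⟨z', w, hzw, hzF, hzb⟩ := split z hz
  have nz : ∀ {a : ℂ} {k : ℕ}, k ≠ 0 → a ^ k = 1 → a ≠ 0 := by
    rintro a k hk h rfl
    rw [zero_pow hk] at h
    exact zero_ne_one h
  have nrm : ∀ {a : ℂ}, a ^ (p * b) = 1 → ‖a‖ = 1 := fun h =>
    Complex.norm_eq_one_of_pow_eq_one h hT.ne'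
  set c : Fin 6 → ℂ := ![x', x'⁻¹, -f * y', -f * y'⁻¹, (f - 1) * z', (f - 1) * z'⁻¹] with hc
  have hcF : ∀ i, c i ∈ ℚ⟮ω⟯ := by
    intro i
    fin_cases i
    exacts [hxF, inv_mem hxF, mul_mem (neg_mem hfF) hyF, mul_mem (neg_mem hfF) (inv_mem hyF),
      mul_mem (sub_mem hfF (one_mem _)) hzF, mul_mem (sub_mem hfF (one_mem _)) (inv_mem hzF)]
  have hsum0 : ∑ i, c i * ξ ^ (![u, -u, v, -v, w, -w] : Fin 6 → ℤ) i = 0 := by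
    simp only [Fin.sum_univ_six, hc]
    rw [hxu, hyv, hzw] at htot
    simp only [mul_inv, ← zpow_neg] at htot
    simp
    simp only [← zpow_neg]
    linear_combination htot
  by_cases hcov : ∀ r : ZMod p, (u : ZMod p) = r ∨ -(u : ZMod p) = r ∨ (v : ZMod p) = r ∨
      -(v : ZMod p) = r ∨ (w : ZMod p) = r ∨ -(w : ZMod p) = r
  · exfalso
    -- Six exponents cannot cover more than six classes.
    have hp' : p = 5 := by
      by_contra h5
      have h6 : p ≠ 6 := by rintro rfl; exact absurd hp (by norm_num)
      exact not_cover_of_six_lt (by omega) _ _ _ hcov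
    subst hp'
    have hyi : IsIntegral ℤ y' := IsIntegral.of_pow hb (by rw [hyb]; exact isIntegral_one)
    have hyi' : IsIntegral ℤ y'⁻¹ :=
      IsIntegral.of_pow hb (by rw [inv_pow, hyb, inv_one]; exact isIntegral_one)
    refine false_of_zmod_five_classSum_eq (nz hb.ne' hxb) (nz hb.ne' hyb) (nz hb.ne' hzb)
      (hyi.add hyi') hf hcov fun r s => ?_
    have := normalized_classSum_eq hξ hp.one_lt hdeg c hcF ![u, -u, v, -v, w, -w] hsum0 r s
    simp only [sum_ite_class_six, hc] at this
    simp at this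
    simp only [one_mul, neg_mul]
    linear_combination this
  · push Not at hcov
    obtain ⟨r₀, hr₀⟩ := hcov
    refine eq_two_of_classSum_eq_zero (u := (u : ZMod p)) (v := (v : ZMod p)) (w := (w : ZMod p))
      (nrm hx) (nrm hy) (nrm hz) hf hxz hxz' (fun r => ?_) ?_ htot
    · have := classSum_eq_zero_of_empty_class hξ hp.one_lt hdeg c hcF ![u, -u, v, -v, w, -w] hsum0
        r₀ (by
          intro i
          fin_cases i <;> simp
          exacts [hr₀.1, hr₀.2.1, hr₀.2.2.1, hr₀.2.2.2.1, hr₀.2.2.2.2.1, hr₀.2.2.2.2.2]) r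
      simp only [sum_ite_class_six, hc] at this
      simp at this
      rw [hxu, hyv, hzw]
      simp only [mul_inv, one_mul, neg_mul, mul_assoc] at this ⊢
      linear_combination this
    · by_contra! h
      refine hne ⟨?_, ?_, ?_⟩
      · rw [hxu, hξk u h.1, mul_one, hxb]
      · rw [hyv, hξk v h.2.1, mul_one, hyb]
      · rw [hzw, hξk w h.2.2, mul_one, hzb]

theorem dvd_of_prime_pow_dvd_mul {p e n c : ℕ} (hp : p.Prime) (h : p ^ e ∣ n * c)
    (hn : ¬ p ^ e ∣ n) : p ∣ c := by
  by_contra hc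
  exact hn ((Nat.Coprime.pow_left e ((Nat.Prime.coprime_iff_not_dvd hp).2 hc)).dvd_of_dvd_mul_right h)

/-- Three roots of unity in a three-cosine relation over `ℚ(ζ_n)` have order dividing
`lcm(2n, 12)`, unless the relation is degenerate. -/
theorem pow_lcm_eq_one_or_eq_two {n L : ℕ} (hn : 0 < n) (hL : 0 < L)
    {x y z : ℂ} {f : ℝ} (hf : 1 < f) (hfn : (f : ℂ) ∈ ℚ⟮zetaRoot n⟯)
    (hxz : x ≠ z) (hxz' : x ≠ z⁻¹)
    (htot : x + x⁻¹ - f * (y + y⁻¹) + (f - 1) * (z + z⁻¹) = 0)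
    (hx : x ^ L = 1) (hy : y ^ L = 1) (hz : z ^ L = 1) :
    (x ^ (Nat.lcm (2 * n) 12) = 1 ∧ y ^ (Nat.lcm (2 * n) 12) = 1 ∧
      z ^ (Nat.lcm (2 * n) 12) = 1) ∨
    (f = 2 ∧ y + y⁻¹ = 0 ∧ x + x⁻¹ + (z + z⁻¹) = 0) := by
  refine or_iff_not_imp_right.2 fun hfam => ?_
  set M := Nat.lcm (2 * n) 12
  have h2nM : 2 * n ∣ M := Nat.dvd_lcm_left _ _
  have h12M : 12 ∣ M := Nat.dvd_lcm_right _ _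
  obtain ⟨N, hN⟩ : ∃ N, N = ((orderOf x).lcm (orderOf y)).lcm (orderOf z) := ⟨_, rfl⟩
  have hNd : ∀ k, N ∣ k ↔ x ^ k = 1 ∧ y ^ k = 1 ∧ z ^ k = 1 := by
    intro k
    rw [hN, Nat.lcm_dvd_iff, Nat.lcm_dvd_iff, orderOf_dvd_iff_pow_eq_one,
      orderOf_dvd_iff_pow_eq_one, orderOf_dvd_iff_pow_eq_one, and_assoc]
  have hN0 : 0 < N := Nat.pos_of_dvd_of_pos ((hNd L).2 ⟨hx, hy, hz⟩) hL
  rw [← hNd, Nat.dvd_iff_prime_pow_dvd_dvd]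
  intro p k hp hpk
  by_contra hpM
  have hT0 : 0 < N.lcm n := Nat.lcm_pos hN0 hn
  have hpT : p ^ k ∣ N.lcm n := hpk.trans (Nat.dvd_lcm_left _ _)
  obtain ⟨hxT, hyT, hzT⟩ := (hNd (N.lcm n)).1 (Nat.dvd_lcm_left _ _)
  -- Minimality of the lcm: if `n` divides `T / p`, the orders cannot all divide it too.
  have hne : n ∣ N.lcm n / p → p ∣ N.lcm n → ¬ (x ^ (N.lcm n / p) = 1 ∧ y ^ (N.lcm n / p) = 1 ∧
      z ^ (N.lcm n / p) = 1) := by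
    intro h1 h2 h
    have h3 := Nat.le_of_dvd (Nat.div_pos (Nat.le_of_dvd hT0 h2) hp.pos)
      (Nat.lcm_dvd ((hNd _).2 h) h1)
    have := Nat.div_lt_self hT0 hp.one_lt
    omega
  have hpn : ¬ p ^ k ∣ n := fun h => hpM (h.trans ((Nat.dvd_mul_left n 2).trans h2nM))
  obtain ⟨c, hc⟩ : n ∣ N.lcm n := Nat.dvd_lcm_right _ _
  obtain ⟨c, rfl⟩ := dvd_of_prime_pow_dvd_mul hp (hc ▸ hpT) hpn
  generalize N.lcm n = T at *
  rcases eq_or_ne p 2 with rfl | hp2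
  -- Modulo `2` every class is its own negative, so `q = 4` is used. The factors `4 ∣ 12` and `2n ∣
  -- M` make room: `8 ∣ T` and `4 ∣ T / n`.
  · have hk : 3 ≤ k := by
      by_contra hk
      exact hpM ((pow_dvd_pow 2 (show k ≤ 2 by omega)).trans
        ((show 2 ^ 2 ∣ 12 by norm_num).trans h12M))
    obtain ⟨j, rfl⟩ : ∃ j, k = j + 1 := ⟨k - 1, by omega⟩
    have hpn' : ¬ 2 ^ j ∣ n := fun h => hpM (by
      rw [pow_succ, mul_comm]; exact (Nat.mul_dvd_mul_left 2 h).trans h2nM)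
    obtain ⟨c, rfl⟩ := dvd_of_prime_pow_dvd_mul (n := n) (c := c) hp (by
      have h := hpT
      rw [hc, pow_succ, mul_comm, mul_left_comm] at h
      exact Nat.dvd_of_mul_dvd_mul_left (by norm_num) h) hpn'
    have hT : T = 4 * (n * c) := by rw [hc]; ring
    subst hT
    have hb : 0 < n * c := by omega
    have h2b : 2 ∣ n * c := by
      have h8 : 2 ^ 3 ∣ 4 * (n * c) := (pow_dvd_pow 2 hk).trans hpT
      omega
    have hφ : (4 * (n * c)).totient = 4 * (n * c).totient := by
      rw [show 4 * (n * c) = 2 * (2 * (n * c)) by ring,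
        Nat.totient_mul_of_prime_of_dvd hp (Nat.dvd_mul_right _ _),
        Nat.totient_mul_of_prime_of_dvd hp h2b]
      ring
    refine hfam (eq_two_of_totient_mul_eq (q := 4) (p := 2) hn hb (Nat.dvd_mul_right _ _) hφ
      (by omega) ?_ hf hfn hxz hxz' htot hxT hyT hzT (hne ?_ (by omega)))
    · intro j hj
      have : ((2 * j : ℤ) : ZMod 4) = 0 := by push_cast; linear_combination hj
      rw [ZMod.intCast_zmod_eq_zero_iff_dvd] at this
      omega
    · exact ⟨2 * c, by rw [show 4 * (n * c) = n * (2 * c) * 2 by ring,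
        Nat.mul_div_cancel _ (by norm_num)]⟩
  · have hT : T = p * (n * c) := by rw [hc]; ring
    subst hT
    have hb : 0 < n * c := Nat.pos_of_mul_pos_left hT0
    have hdiv : p * (n * c) / p = n * c := Nat.mul_div_cancel_left _ hp.pos
    have : NeZero p := ⟨hp.ne_zero⟩
    have : Fact p.Prime := ⟨hp⟩
    have hne' := hne (by rw [hdiv]; exact Nat.dvd_mul_right _ _) (Nat.dvd_mul_right _ _)
    by_cases hpb : p ∣ n * c
    · refine hfam (eq_two_of_totient_mul_eq (q := p) (p := p) hn hb (Nat.dvd_mul_right _ _)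
        (Nat.totient_mul_of_prime_of_dvd hp hpb) (Nat.dvd_mul_right _ _) ?_ hf hfn hxz hxz' htot
        hxT hyT hzT hne')
      intro j hj
      have h2 : ((2 * j : ℤ) : ZMod p) = 0 := by push_cast; linear_combination hj
      rw [ZMod.intCast_zmod_eq_zero_iff_dvd] at h2
      rcases (Nat.prime_iff_prime_int.1 hp).dvd_or_dvd h2 with h | h
      · exact absurd ((Nat.prime_dvd_prime_iff_eq hp Nat.prime_two).1 (by exact_mod_cast h)) hp2
      · exact h
    · rw [hdiv] at hne'
      -- If `3` divided `T` only once, that factor would already divide `12`.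
      have h3 : p ≠ 3 := by
        rintro rfl
        have hk : k ≤ 1 := by
          by_contra hk
          have := (pow_dvd_pow 3 (show 2 ≤ k by omega)).trans hpT
          omega
        exact hpM ((pow_dvd_pow 3 hk).trans ((show 3 ^ 1 ∣ 12 by norm_num).trans h12M))
      have h4 : p ≠ 4 := by rintro rfl; exact absurd hp (by norm_num)
      exact hfam (eq_two_of_prime_not_dvd hp (by have := hp.two_le; omega) hpb hn hb
        (Nat.dvd_mul_right _ _) hf hfn hxz hxz' htot hxT hyT hzT hne')

/-! ### Half-angle roots of unity and the relation attached to a tuple -/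

/-- The root of unity `e^{πik/m}`. -/
noncomputable def halfRoot (m : ℕ) (k : ℤ) : ℂ := Complex.exp ((π * k / m : ℝ) * Complex.I)

theorem halfRoot_add (m : ℕ) (j k : ℤ) : halfRoot m (j + k) = halfRoot m j * halfRoot m k := by
  rw [halfRoot, halfRoot, halfRoot, ← Complex.exp_add]
  congr 1
  push_cast
  ring

theorem halfRoot_neg (m : ℕ) (k : ℤ) : halfRoot m (-k) = (halfRoot m k)⁻¹ := by
  rw [halfRoot, halfRoot, ← Complex.exp_neg]
  congr 1
  push_cast
  ring

theorem halfRoot_ne_zero (m : ℕ) (k : ℤ) : halfRoot m k ≠ 0 := Complex.exp_ne_zero _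

theorem halfRoot_two_mul (m k : ℕ) : halfRoot m (2 * k) = zetaRoot m ^ k := by
  rw [halfRoot, zetaRoot, ← Complex.exp_nat_mul]
  congr 1
  push_cast
  ring

theorem halfRoot_pow_two_mul {m : ℕ} (hm : 0 < m) (k : ℤ) : halfRoot m k ^ (2 * m) = 1 := by
  rw [halfRoot, ← Complex.exp_nat_mul, Complex.exp_eq_one_iff]
  refine ⟨k, ?_⟩
  have : (m : ℂ) ≠ 0 := by exact_mod_cast hm.ne'
  push_cast
  field_simp

theorem halfRoot_add_inv (m : ℕ) (k : ℤ) :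
    halfRoot m k + (halfRoot m k)⁻¹ = ((2 * Real.cos (π * k / m) : ℝ) : ℂ) := by
  rw [← halfRoot_neg, halfRoot, halfRoot]
  push_cast
  rw [Complex.cos, mul_neg, neg_div, neg_mul]
  ring

theorem one_sub_zetaRoot_pow_ne_zero {m k : ℕ} (hk : 0 < k) (hkm : k < m) :
    1 - zetaRoot m ^ k ≠ 0 := by
  rw [sub_ne_zero]
  intro h
  have := ((isPrimitiveRoot_zetaRoot (by omega : 0 < m)).pow_eq_one_iff_dvd k).1 h.symm
  exact absurd (Nat.le_of_dvd hk this) (by omega)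

/-- The prefactor depends only on `a + b`, so it cancels in `crossF` because `k₁ + k₂ = k₃ + k₄`. -/
theorem one_sub_mul_one_sub_eq (m a b : ℕ) :
    (1 - zetaRoot m ^ a) * (1 - zetaRoot m ^ b) =
      halfRoot m (a + b) * ((halfRoot m (a + b) + (halfRoot m (a + b))⁻¹) -
        (halfRoot m (b - a) + (halfRoot m (b - a))⁻¹)) := by
  have ha : zetaRoot m ^ a = halfRoot m (a + b) * (halfRoot m (b - a))⁻¹ := by
    rw [← halfRoot_two_mul, ← halfRoot_neg, ← halfRoot_add]; congr 1; ring
  have hb : zetaRoot m ^ b = halfRoot m (a + b) * halfRoot m (b - a) := by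
    rw [← halfRoot_two_mul, ← halfRoot_add]; congr 1; ring
  have h1 := halfRoot_ne_zero m (a + b)
  have h2 := halfRoot_ne_zero m (b - a)
  rw [ha, hb]
  field_simp
  ring

/-- The difference is `2 sin(πa/m) sin(πb/m)`. -/
theorem cos_sub_cos_pos {m : ℕ} {a b : ℤ} (ha : 0 < a) (ham : a < m) (hb : 0 < b) (hbm : b < m) :
    0 < Real.cos (π * (b - a : ℤ) / m) - Real.cos (π * (a + b : ℤ) / m) := by
  have hm : (0 : ℝ) < m := by
    have : 0 < m := by omega
    exact_mod_cast this
  have hpos : ∀ c : ℤ, 0 < c → c < m → 0 < Real.sin (π * c / m) := by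
    intro c hc hcm
    have hc' : (0 : ℝ) < c := by exact_mod_cast hc
    have hcm' : (c : ℝ) < m := by exact_mod_cast hcm
    apply Real.sin_pos_of_pos_of_lt_pi
    · positivity
    · rw [div_lt_iff₀ hm]
      exact mul_lt_mul_of_pos_left hcm' Real.pi_pos
  have h1 : (π * (b - a : ℤ) / m : ℝ) = π * b / m - π * a / m := by push_cast; ring
  have h2 : (π * (a + b : ℤ) / m : ℝ) = π * a / m + π * b / m := by push_cast; ring
  rw [h1, h2, Real.cos_sub, Real.cos_add]
  have := mul_pos (hpos a ha ham) (hpos b hb hbm)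
  linarith

theorem two_mul_eq_of_cos_eq_zero {m : ℕ} {a : ℤ} (ha : 0 < a) (ham : a < m)
    (h : Real.cos (π * a / m) = 0) : 2 * a = m := by
  have hm : (0 : ℝ) < m := by
    have : 0 < m := by omega
    exact_mod_cast this
  have ha' : (0 : ℝ) < a := by exact_mod_cast ha
  have ham' : (a : ℝ) < m := by exact_mod_cast ham
  have h1 : π * a / m ∈ Set.Icc 0 π :=
    ⟨by positivity, by rw [div_le_iff₀ hm]; exact mul_le_mul_of_nonneg_left ham'.le Real.pi_pos.le⟩
  have h2 : π / 2 ∈ Set.Icc 0 π := ⟨by positivity, by linarith [Real.pi_pos]⟩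
  have h3 := Real.injOn_cos h1 h2 (h.trans Real.cos_pi_div_two.symm)
  have h4 : (2 * a : ℝ) = m := by
    have := Real.pi_pos.ne'
    field_simp at h3
    linarith
  exact_mod_cast h4

theorem exists_three_cosine_relation {m : ℕ} {d : Fin 4 → ℕ} (hd : d ∈ tupleSet m) :
    ∃ f : ℝ, 1 < f ∧ crossF m d = f ∧
      halfRoot m (d 1 - d 0) ≠ halfRoot m (d 0 + d 1) ∧
      halfRoot m (d 1 - d 0) ≠ (halfRoot m (d 0 + d 1))⁻¹ ∧
      halfRoot m (d 1 - d 0) + (halfRoot m (d 1 - d 0))⁻¹ -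
        f * (halfRoot m (d 3 - d 2) + (halfRoot m (d 3 - d 2))⁻¹) +
        (f - 1) * (halfRoot m (d 0 + d 1) + (halfRoot m (d 0 + d 1))⁻¹) = 0 := by
  obtain ⟨hpos, h20, h01, h13, h3m, hs⟩ := hd
  have hp2 := hpos 2
  have hsum : ((d 2 : ℤ) + d 3) = d 0 + d 1 := by exact_mod_cast hs.symm
  have hm : (0 : ℝ) < m := by
    have : 0 < m := by omega
    exact_mod_cast this
  have c1 := cos_sub_cos_pos (m := m) (a := d 0) (b := d 1) (by omega) (by omega) (by omega)
    (by omega)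
  have c2 := cos_sub_cos_pos (m := m) (a := d 2) (b := d 3) (by omega) (by omega) (by omega)
    (by omega)
  rw [hsum] at c2
  have c3 : Real.cos (π * (d 3 - d 2 : ℤ) / m) < Real.cos (π * (d 1 - d 0 : ℤ) / m) := by
    have e1 : ((0 : ℤ) : ℝ) ≤ ((d 1 - d 0 : ℤ) : ℝ) := Int.cast_le.2 (by omega)
    have e2 : ((d 1 - d 0 : ℤ) : ℝ) < ((d 3 - d 2 : ℤ) : ℝ) := Int.cast_lt.2 (by omega)
    have e3 : ((d 3 - d 2 : ℤ) : ℝ) ≤ ((m : ℤ) : ℝ) := Int.cast_le.2 (by omega)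
    rw [Int.cast_zero] at e1
    apply Real.cos_lt_cos_of_nonneg_of_le_pi
    · have := Real.pi_pos
      positivity
    · rw [div_le_iff₀ hm]
      exact mul_le_mul_of_nonneg_left (by exact_mod_cast e3) Real.pi_pos.le
    · exact div_lt_div_of_pos_right (mul_lt_mul_of_pos_left e2 Real.pi_pos) hm
  have hne : halfRoot m (d 1 - d 0) + (halfRoot m (d 1 - d 0))⁻¹ ≠
      halfRoot m (d 0 + d 1) + (halfRoot m (d 0 + d 1))⁻¹ := by
    rw [halfRoot_add_inv, halfRoot_add_inv, Ne, Complex.ofReal_inj]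
    intro h
    linarith
  have eA := halfRoot_add_inv m (d 1 - d 0)
  have eB := halfRoot_add_inv m (d 3 - d 2)
  have eS := halfRoot_add_inv m (d 0 + d 1)
  generalize Real.cos (π * (d 1 - d 0 : ℤ) / m) = A at *
  generalize Real.cos (π * (d 3 - d 2 : ℤ) / m) = B at *
  generalize Real.cos (π * (d 0 + d 1 : ℤ) / m) = S at *
  have hBS : ((B - S : ℝ) : ℂ) ≠ 0 := by exact_mod_cast c2.ne'
  -- Since `A > B > S`, this quotient exceeds `1`.
  refine ⟨(A - S) / (B - S), by rw [lt_div_iff₀ c2]; linarith, ?_, ?_, ?_, ?_⟩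
  · rw [crossF, one_sub_mul_one_sub_eq, one_sub_mul_one_sub_eq, hsum, eA, eB, eS,
      mul_div_mul_left _ _ (halfRoot_ne_zero _ _)]
    rw [← Complex.ofReal_sub, ← Complex.ofReal_sub, ← Complex.ofReal_div, Complex.ofReal_inj,
      ← mul_sub, ← mul_sub, mul_div_mul_left _ _ two_ne_zero, ← neg_div_neg_eq, neg_sub, neg_sub]
  · exact fun h => hne (by rw [h])
  · exact fun h => hne (by rw [h, inv_inv, add_comm])
  · rw [eA, eB, eS]
    push_cast at hBS ⊢
    field_simp
    ring

/-- In the degenerate case the tuple belongs to one of the two infinite families. -/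
theorem family_of_degenerate {m : ℕ} {d : Fin 4 → ℕ} (hm : 4 ≤ m) (hd : d ∈ tupleSet m)
    (hy : halfRoot m (d 3 - d 2) + (halfRoot m (d 3 - d 2))⁻¹ = 0)
    (hxz : halfRoot m (d 1 - d 0) + (halfRoot m (d 1 - d 0))⁻¹ +
      (halfRoot m (d 0 + d 1) + (halfRoot m (d 0 + d 1))⁻¹) = 0) :
    IsFirstFamily m d ∨ IsSecondFamily m d := by
  obtain ⟨hpos, h20, h01, h13, h3m, hs⟩ := hd
  have hp2 := hpos 2
  rw [halfRoot_add_inv] at hy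
  rw [halfRoot_add_inv, halfRoot_add_inv] at hxz
  have hy' : Real.cos (π * (d 3 - d 2 : ℤ) / m) = 0 := by
    have : 2 * Real.cos (π * (d 3 - d 2 : ℤ) / m) = 0 := by exact_mod_cast hy
    linarith
  have h32 := two_mul_eq_of_cos_eq_zero (by omega) (by omega) hy'
  -- Sum-to-product: one of `k₁, k₂` must equal `m / 2`, which decides the family.
  have hprod : Real.cos (π * (d 0 : ℤ) / m) * Real.cos (π * (d 1 : ℤ) / m) = 0 := by
    have : 2 * Real.cos (π * (d 1 - d 0 : ℤ) / m) + 2 * Real.cos (π * (d 0 + d 1 : ℤ) / m) = 0 := by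
      exact_mod_cast hxz
    have h1 : (π * (d 1 - d 0 : ℤ) / m : ℝ) = π * (d 1 : ℤ) / m - π * (d 0 : ℤ) / m := by
      push_cast; ring
    have h2 : (π * (d 0 + d 1 : ℤ) / m : ℝ) = π * (d 0 : ℤ) / m + π * (d 1 : ℤ) / m := by
      push_cast; ring
    rw [h1, h2, Real.cos_sub, Real.cos_add] at this
    linarith
  have hd4 : d = ![d 0, d 1, d 2, d 3] := by
    ext i; fin_cases i <;> rfl
  rcases mul_eq_zero.1 hprod with h | h
  · have h0 := two_mul_eq_of_cos_eq_zero (by omega) (by omega) h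
    refine Or.inr ⟨d 0, d 2, by omega, by omega, by omega, by omega, ?_⟩
    rw [show 2 * d 2 = d 1 by omega, show d 2 + d 0 = d 3 by omega]
    exact hd4
  · have h1 := two_mul_eq_of_cos_eq_zero (by omega) (by omega) h
    refine Or.inl ⟨d 1, d 2, by omega, by omega, by omega, by omega, ?_⟩
    rw [show 2 * d 2 = d 0 by omega, show d 2 + d 1 = d 3 by omega]
    exact hd4

/-- The powers `ζ_m^{kᵢ}` are recovered as `z x⁻¹`, `z x`, `z y⁻¹`, `z y`, so they are `M`-th roots
of unity when `x, y, z` are. -/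
theorem dvd_or_family_of_mem {n m : ℕ} {d : Fin 4 → ℕ} (hn : 0 < n) (hm : 4 ≤ m)
    (hd : d ∈ tupleSet m) (hmem : crossF m d ∈ realCyclotomic n) :
    (crossF m d = 2 ∧ (IsFirstFamily m d ∨ IsSecondFamily m d)) ∨
      ∀ i, m ∣ d i * Nat.lcm (2 * n) 12 := by
  obtain ⟨f, hf, hfd, hne, hne', htot⟩ := exists_three_cosine_relation hd
  have hm0 : 0 < m := by omega
  rcases pow_lcm_eq_one_or_eq_two (L := 2 * m) hn (by omega) hf
    (by rw [← hfd]; exact hmem.1) hne hne' htot (halfRoot_pow_two_mul hm0 _)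
    (halfRoot_pow_two_mul hm0 _) (halfRoot_pow_two_mul hm0 _) with ⟨hx, hy, hz⟩ | ⟨h2, hy, hxz⟩
  · right
    obtain ⟨hpos, h20, h01, h13, h3m, hs⟩ := hd
    have hsum : ((d 0 : ℤ) + d 1) = d 2 + d 3 := by exact_mod_cast hs
    have key : ∀ (k : ℕ) (t : ℂ), t ^ (Nat.lcm (2 * n) 12) = 1 → zetaRoot m ^ k = t →
        m ∣ k * Nat.lcm (2 * n) 12 := by
      intro k t ht hk
      rw [← (isPrimitiveRoot_zetaRoot hm0).pow_eq_one_iff_dvd, pow_mul, hk, ht]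
    have mul_inv_pow : ∀ {s t : ℂ}, s ^ (Nat.lcm (2 * n) 12) = 1 → t ^ (Nat.lcm (2 * n) 12) = 1 →
        (s * t⁻¹) ^ (Nat.lcm (2 * n) 12) = 1 := by
      intro s t h1 h2
      rw [mul_pow, inv_pow, h1, h2, inv_one, mul_one]
    have mul_pow' : ∀ {s t : ℂ}, s ^ (Nat.lcm (2 * n) 12) = 1 → t ^ (Nat.lcm (2 * n) 12) = 1 →
        (s * t) ^ (Nat.lcm (2 * n) 12) = 1 := by
      intro s t h1 h2
      rw [mul_pow, h1, h2, mul_one]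
    intro i
    fin_cases i
    · refine key _ _ (mul_inv_pow hz hx) ?_
      rw [← halfRoot_two_mul, ← halfRoot_neg, ← halfRoot_add]; congr 1; simp; ring
    · refine key _ _ (mul_pow' hz hx) ?_
      rw [← halfRoot_two_mul, ← halfRoot_add]; congr 1; simp; ring
    · refine key _ _ (mul_inv_pow hz hy) ?_
      rw [← halfRoot_two_mul, ← halfRoot_neg, ← halfRoot_add, hsum]; congr 1; simp; ring
    · refine key _ _ (mul_pow' hz hy) ?_
      rw [← halfRoot_two_mul, ← halfRoot_add, hsum]; congr 1; simp; ring
  · left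
    refine ⟨by rw [hfd, h2]; norm_num, family_of_degenerate hm hd hy hxz⟩

/-! ### Rescaling to level `M` and conclusion -/

theorem zetaRoot_pow_eq_of_mul_eq {m m' k k' : ℕ} (hm : 0 < m) (hm' : 0 < m')
    (h : k * m' = k' * m) : zetaRoot m ^ k = zetaRoot m' ^ k' := by
  rw [zetaRoot, zetaRoot, ← Complex.exp_nat_mul, ← Complex.exp_nat_mul]
  congr 1
  have h1 : (m : ℂ) ≠ 0 := by exact_mod_cast hm.ne'
  have h2 : (m' : ℂ) ≠ 0 := by exact_mod_cast hm'.ne'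
  have h3 : (k : ℂ) * m' = k' * m := by exact_mod_cast h
  field_simp
  rw [h3, mul_comm]

theorem crossF_eq_of_mul_eq {m m' : ℕ} {d d' : Fin 4 → ℕ} (hm : 0 < m) (hm' : 0 < m')
    (h : ∀ i, d i * m' = d' i * m) : crossF m d = crossF m' d' := by
  simp only [crossF, fun i => zetaRoot_pow_eq_of_mul_eq hm hm' (h i)]

theorem SameUpToFactor.mul_eq {m m' : ℕ} {d d' : Fin 4 → ℕ} (h : SameUpToFactor m d m' d')
    (i : Fin 4) : d i * m' = d' i * m := by
  obtain ⟨c, -, hm, hd⟩ := h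
  have : (d i * m' : ℚ) = d' i * m := by rw [hm, hd]; ring
  exact_mod_cast this

theorem exists_sameUpToFactor {m M : ℕ} {d : Fin 4 → ℕ} (hM : 0 < M) (hd : d ∈ tupleSet m)
    (h : ∀ i, m ∣ d i * M) : ∃ d' ∈ tupleSet M, SameUpToFactor m d M d' := by
  choose d' hd' using h
  obtain ⟨hpos, h20, h01, h13, h3m, hs⟩ := hd
  have hm : 0 < m := by omega
  have e : ∀ i j, d i < d j → d' i < d' j := fun i j hij => by
    have := Nat.mul_lt_mul_of_pos_right hij hM
    rw [hd', hd'] at this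
    exact Nat.lt_of_mul_lt_mul_left this
  refine ⟨d', ⟨fun i => ?_, e _ _ h20, ?_, e _ _ h13, ?_, ?_⟩, m / M, by positivity, ?_, fun i => ?_⟩
  · have := Nat.mul_pos (hpos i) hM
    rw [hd'] at this
    exact Nat.pos_of_mul_pos_left this
  · have := Nat.mul_le_mul_right M h01
    rw [hd', hd'] at this
    exact Nat.le_of_mul_le_mul_left this hm
  · have := Nat.mul_lt_mul_of_pos_right h3m hM
    rw [hd'] at this
    exact Nat.lt_of_mul_lt_mul_left this
  · refine Nat.eq_of_mul_eq_mul_left hm ?_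
    rw [mul_add, mul_add, ← hd', ← hd', ← hd', ← hd', ← add_mul, ← add_mul, hs]
  · field_simp
  · have : (d i * M : ℚ) = m * d' i := by exact_mod_cast hd' i
    field_simp
    linarith

theorem tupleSet_finite (m : ℕ) : (tupleSet m).Finite := by
  refine (Set.finite_Iic (fun _ : Fin 4 => m)).subset fun d hd i => ?_
  obtain ⟨hpos, h20, h01, h13, h3m, hs⟩ := hd
  fin_cases i
  all_goals
    simp
    omega

theorem two_mem_crossSet {m : ℕ} (hm : 4 ≤ m) (h2 : 2 ∣ m) : (2 : ℂ) ∈ crossSet m := by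
  obtain ⟨s, rfl⟩ := h2
  -- The member `k = 1` of the first family.
  refine ⟨![2, s, 1, 1 + s], ⟨?_, ?_⟩, ?_⟩
  · intro i
    fin_cases i <;> (simp; try omega)
  · simp
    omega
  · have hζ := isPrimitiveRoot_zetaRoot (by omega : 0 < 2 * s)
    have hs : zetaRoot (2 * s) ^ s = -1 :=
      (hζ.pow (by omega) (mul_comm 2 s)).eq_neg_one_of_two_right
    have h1 := one_sub_zetaRoot_pow_ne_zero (m := 2 * s) (k := 1) (by omega) (by omega)
    have h3 := one_sub_zetaRoot_pow_ne_zero (m := 2 * s) (k := 1 + s) (by omega) (by omega)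
    rw [crossF]
    simp only [Matrix.cons_val]
    rw [div_eq_iff (mul_ne_zero h1 h3), hs, pow_add, hs]
    ring

theorem theorem4p5 (n : ℕ) (hn : 0 < n) :
    crossSetAll ∩ (realCyclotomic n : Set ℂ) =
        crossSet (Nat.lcm (2 * n) 12) ∩ (realCyclotomic n : Set ℂ) ∧
    (crossSet (Nat.lcm (2 * n) 12) ∩ (realCyclotomic n : Set ℂ)).Finite ∧
    ∃ S : Finset (Fin 4 → ℕ), (S : Set (Fin 4 → ℕ)) ⊆ tupleSet (Nat.lcm (2 * n) 12) ∧
      ∀ (m : ℕ) (d : Fin 4 → ℕ), 4 ≤ m → d ∈ tupleSet m →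
        (crossF m d ∈ realCyclotomic n ↔
          (crossF m d = 2 ∧ (IsFirstFamily m d ∨ IsSecondFamily m d)) ∨
          ∃ d' ∈ S, SameUpToFactor m d (Nat.lcm (2 * n) 12) d') := by
  have hM0 : 0 < Nat.lcm (2 * n) 12 := Nat.lcm_pos (by omega) (by norm_num)
  have hM12 : 12 ∣ Nat.lcm (2 * n) 12 := Nat.dvd_lcm_right _ _
  have hM4 : 4 ≤ Nat.lcm (2 * n) 12 := by omega
  have hfin := tupleSet_finite (Nat.lcm (2 * n) 12)
  refine ⟨?_, (hfin.image _).subset Set.inter_subset_left, ?_⟩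
  · ext z
    constructor
    · rintro ⟨⟨m, hm, d, hd, rfl⟩, hz⟩
      refine ⟨?_, hz⟩
      rcases dvd_or_family_of_mem hn hm hd hz with ⟨h2, -⟩ | h
      · rw [h2]
        exact two_mem_crossSet hM4 (by omega)
      · obtain ⟨d', hd', hs⟩ := exists_sameUpToFactor hM0 hd h
        exact ⟨d', hd', (crossF_eq_of_mul_eq (by omega) hM0 hs.mul_eq).symm⟩
    · rintro ⟨hz, hz'⟩
      exact ⟨⟨_, hM4, hz⟩, hz'⟩
  -- `S` consists of all tuples of `D_M` whose value lies in the field.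
  · refine ⟨(hfin.subset (Set.sep_subset _
      fun d => crossF (Nat.lcm (2 * n) 12) d ∈ realCyclotomic n)).toFinset, ?_, ?_⟩
    · rw [Set.Finite.coe_toFinset]
      exact Set.sep_subset _ _
    · intro m d hm hd
      simp only [Set.Finite.mem_toFinset]
      constructor
      · intro hz
        refine (dvd_or_family_of_mem hn hm hd hz).imp_right fun h => ?_
        obtain ⟨d', hd', hs⟩ := exists_sameUpToFactor hM0 hd h
        exact ⟨d', ⟨hd', by rwa [← crossF_eq_of_mul_eq (by omega) hM0 hs.mul_eq]⟩, hs⟩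
      · rintro (⟨h2, -⟩ | ⟨d', ⟨-, hz⟩, hs⟩)
        · rw [h2]
          exact ofNat_mem _ 2
        · rwa [crossF_eq_of_mul_eq (by omega) hM0 hs.mul_eq]
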